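/- Let $\mathcal A$ be a set of actions, $\tau\notin\mathcal A$ the silent action, and $a,b,c\in\mathcal A$ distinct. The *counter with a change* is the parallel pushdown automaton with a single state $\uparrow$, initial and accepting, a single datum $1$, and the three transitions $\uparrow\xrightarrow{c[-1/\{1\}]}\uparrow$, $\uparrow\xrightarrow{a[+1/\{1,1\}]}\uparrow$, $\uparrow\xrightarrow{b[+1/\emptyset]}\uparrow$ (curly brackets denote multisets). The states of its process graph are the pairs $(\uparrow,x)$ with $x$ a finite multiset over $\{1\}$ (the bag); the root is $(\uparrow,\emptyset)$ and all states are accepting. A transition labelled $[+1/y]$ is possible when $1$ is in the bag, and replaces one occurrence of $1$ by the multiset $y$; a transition labelled $[-1/y]$ is possible when $1$ is not in the bag, and adds $y$ to the bag. A finite $\mathrm{BPP}^{\delta\epsilon}$ specification consists of a finite set $\mathcal P$ of identifiers and a map $\Gamma$ that assigns to each $X\in\mathcal P$ an expression from the grammar $$p ::= \delta \mid \epsilon \mid \alpha.p \mid p+p \mid p\parallel p \mid X\qquad(\alpha\in\mathcal A\cup\{\tau\},\ X\in\mathcal P).$$ It is weakly guarded if every occurrence of an identifier in every $\Gamma(X)$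 is within the scope of an action prefix $\alpha.\_$ with $\alpha\in\mathcal A\cup\{\tau\}$. Its process graph with initial identifier $X$ has the expressions as states and $X$ as root; its transitions $\xrightarrow{\alpha}$ and accepting states $\downarrow$ are the least ones such that: $\epsilon\downarrow$; $\alpha.p\xrightarrow{\alpha}p$; $p+q$ has all transitions of $p$ and of $q$, and accepts if $p$ or $q$ does; if $p\xrightarrow{\alpha}p'$ then $p\parallel q\xrightarrow{\alpha}p'\parallel q$ and $q\parallel p\xrightarrow{\alpha}q\parallel p'$; $p\parallel q$ accepts if both $p$ and $q$ do; $X$ has all transitions of $\Gamma(X)$, and accepts if $\Gamma(X)$ does. Write $\Rightarrow$ (respectively $\Rightarrow^+$) for zero or more (respectively one or more) $\tau$-steps, and $s\xrightarrow{(\alpha)}t$ for "$s\xrightarrow{\alpha}t$, or $\alpha=\tau$ and $s=t$". A symmetric relation $R$ on the states of a labelled transition system is a branching bisimulation if $s\mathrel R t$ implies: (1) whenever $s\xrightarrow{\alpha}s'$, there are $t',t''$ with $t\Rightarrow t''\xrightarrow{(\alpha)}t'$, $s\mathrel R t''$ and $s'\mathrel R t'$; (2) if $s\downarrow$, then there is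 $t'$ with $t\Rightarrow t'$ and $t'\downarrow$. It is divergence-preserving if, whenever $s_0\xrightarrow{\tau}s_1\xrightarrow{\tau}\cdots$ is an infinite sequence and $s_i\mathrel R t$ for all $i\ge 0$, there is $t'$ with $t\Rightarrow^+t'$ and $s_i\mathrel R t'$ for some $i\ge 0$. Two process graphs are divergence-preserving branching bisimilar if their roots are related by a divergence-preserving branching bisimulation on the disjoint union of the two graphs. **Theorem.** There are no finite weakly guarded $\mathrm{BPP}^{\delta\epsilon}$ specification $\Gamma$ and initial identifier $X$ such that the process graph of $\Gamma$ with initial identifier $X$ is divergence-preserving branching bisimilar to the process graph of the counter with a change. -/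

import Mathlib

/-! Labels are elements of `Option A`: `some a` is the action `a`, and `none` is the silent
action `τ`, which is thereby not an element of the set `A` of actions. -/

/-- A labelled transition system with actions `A` and states `S`. -/
structure LTS (S : Type*) (A : Type*) where
  /-- the transition relation, labelled by actions and `τ` -/
  step : S → Option A → S → Prop
  /-- the accepting states -/
  accepting : S → Prop

namespace LTS

variable {S : Type*} {A : Type*} (T : LTS S A)

/-- `s ⇒ t`: a possibly empty sequence of `τ`-steps. -/
def TauSteps (s t : S) : Prop :=
  Relation.ReflTransGen (fun x y => T.step x none y) s t

/-- `s ⇒⁺ t`: a sequence of at least one `τ`-step. -/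
def TauStepsPlus (s t : S) : Prop :=
  Relation.TransGen (fun x y => T.step x none y) s t

/-- `s -(a)→ t`: either `s -a→ t`, or `a = τ` and `s = t`. -/
def OptStep (s : S) (a : Option A) (t : S) : Prop :=
  T.step s a t ∨ (a = none ∧ s = t)

/-- Branching bisimulations on a labelled transition system. -/
structure IsBranchingBisimulation (R : S → S → Prop) : Prop where
  symm : ∀ s t, R s t → R t s
  transfer : ∀ s t, R s t → ∀ (a : Option A) (s' : S), T.step s a s' →
    ∃ t' t'' : S, T.TauSteps t t'' ∧ T.OptStep t'' a t' ∧ R s t'' ∧ R s' t'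
  accept : ∀ s t, R s t → T.accepting s → ∃ t' : S, T.TauSteps t t' ∧ T.accepting t'

/-- The divergence-preservation condition on a relation. -/
def DivergencePreserving (R : S → S → Prop) : Prop :=
  ∀ (s t : S) (f : ℕ → S), f 0 = s → (∀ i, T.step (f i) none (f (i + 1))) →
    (∀ i, R (f i) t) → ∃ t' : S, T.TauStepsPlus t t' ∧ ∃ i, R (f i) t'

/-- Divergence-preserving branching bisimilarity of two states. -/
def DPBranchingBisimilar (s t : S) : Prop :=
  ∃ R : S → S → Prop, T.IsBranchingBisimulation R ∧ T.DivergencePreserving R ∧ R s t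

/-- The disjoint union of two labelled transition systems over the same actions. -/
def disjointUnion {S₁ S₂ : Type*} (T₁ : LTS S₁ A) (T₂ : LTS S₂ A) : LTS (S₁ ⊕ S₂) A where
  step
    | .inl s, a, .inl s' => T₁.step s a s'
    | .inr s, a, .inr s' => T₂.step s a s'
    | _, _, _ => False
  accepting
    | .inl s => T₁.accepting s
    | .inr s => T₂.accepting s

end LTS

/-- A process graph: a labelled transition system with a root state. -/
structure PGraph (S : Type*) (A : Type*) extends LTS S A where
  root : S

/-- Two process graphs are divergence-preserving branching bisimilar if their roots are so
in the disjoint union of the two graphs. -/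
def PGraph.DPBranchingBisimilar {S₁ S₂ A : Type*} (G : PGraph S₁ A) (H : PGraph S₂ A) : Prop :=
  (LTS.disjointUnion G.toLTS H.toLTS).DPBranchingBisimilar (.inl G.root) (.inr H.root)

/-- The two disjoint copies of the data alphabet: `pos d` is `+d` (get a `d` from the bag),
`neg d` is `-d` (there is no `d` in the bag). -/
inductive BagTest (D : Type*) where
  | pos (d : D) : BagTest D
  | neg (d : D) : BagTest D

/-- Parallel pushdown automata with finite sets of states `S` and data `D`. The input alphabet
is a finite subset of a type `A`. Bags are finite multisets. -/
structure PPDA (S : Type*) (A : Type*) (D : Type*) [Finite S] [Finite D] where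
  /-- the input alphabet -/
  alphabet : Set A
  alphabet_finite : alphabet.Finite
  /-- `(s, a, e, x, t)` is the transition `s -a[e/x]→ t` -/
  trans : Set (S × Option A × BagTest D × Multiset D × S)
  trans_finite : trans.Finite
  trans_alphabet : ∀ s a e x t, (s, some a, e, x, t) ∈ trans → a ∈ alphabet
  /-- the initial state -/
  init : S
  /-- the accepting states -/
  final : Set S

namespace PPDA

variable {S A D : Type*} [Finite S] [Finite D]

/-- The transitions between configurations (a state and the contents of the bag). -/
inductive Step (M : PPDA S A D) : S × Multiset D → Option A → S × Multiset D → Prop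
  | pos {s s' : S} {a : Option A} {d : D} {x x' : Multiset D} :
      (s, a, BagTest.pos d, x', s') ∈ M.trans → Step M (s, {d} + x) a (s', x' + x)
  | neg {s s' : S} {a : Option A} {d : D} {x x' : Multiset D} :
      d ∉ x → (s, a, BagTest.neg d, x', s') ∈ M.trans → Step M (s, x) a (s', x' + x)

/-- The process graph of a parallel pushdown automaton. -/
def graph (M : PPDA S A D) : PGraph (S × Multiset D) A where
  step := M.Step
  accepting q := q.1 ∈ M.final
  root := (M.init, 0)

end PPDA

/-- The counter with a change: one state, which is initial and accepting, one datum `1`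
(the element `()` of `Unit`), and the transitions `c[-1/{1}]`, `a[+1/{1,1}]`, `b[+1/∅]`. -/
def counterWithChange {A : Type*} (a b c : A) : PPDA Unit A Unit where
  alphabet := {a, b, c}
  alphabet_finite := by simp
  trans := {((), some c, BagTest.neg (), {()}, ()),
            ((), some a, BagTest.pos (), {(), ()}, ()),
            ((), some b, BagTest.pos (), 0, ())}
  trans_finite := by simp
  trans_alphabet := by
    intro s a' e x t h
    simp only [Set.mem_insert_iff, Set.mem_singleton_iff, Prod.mk.injEq, Option.some.injEq] at h ⊢
    tauto
  init := ()
  final := Set.univ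

/-- Parallel process expressions over actions `A` and identifiers `P`. -/
inductive BPP (A : Type*) (P : Type*) where
  /-- deadlock -/
  | dl : BPP A P
  /-- acceptance -/
  | emp : BPP A P
  /-- action prefix `a.p`, with `a` an action or `τ` -/
  | pre (a : Option A) (p : BPP A P) : BPP A P
  /-- alternative composition -/
  | alt (p q : BPP A P) : BPP A P
  /-- parallel composition -/
  | par (p q : BPP A P) : BPP A P
  /-- process identifier -/
  | ident (X : P) : BPP A P

namespace BPP

variable {A P : Type*}

/-- Acceptance of expressions, with respect to the recursive specification `Γ`. -/
inductive Accepts (Γ : P → BPP A P) : BPP A P → Prop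
  | emp : Accepts Γ .emp
  | alt_left {p q : BPP A P} : Accepts Γ p → Accepts Γ (.alt p q)
  | alt_right {p q : BPP A P} : Accepts Γ q → Accepts Γ (.alt p q)
  | par {p q : BPP A P} : Accepts Γ p → Accepts Γ q → Accepts Γ (.par p q)
  | ident {X : P} : Accepts Γ (Γ X) → Accepts Γ (.ident X)

/-- Transitions of expressions, with respect to the recursive specification `Γ`. -/
inductive Step (Γ : P → BPP A P) : BPP A P → Option A → BPP A P → Prop
  | pre {a : Option A} {p : BPP A P} : Step Γ (.pre a p) a p
  | alt_left {a : Option A} {p q p' : BPP A P} : Step Γ p a p' → Step Γ (.alt p q) a p'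
  | alt_right {a : Option A} {p q q' : BPP A P} : Step Γ q a q' → Step Γ (.alt p q) a q'
  | par_left {a : Option A} {p q p' : BPP A P} :
      Step Γ p a p' → Step Γ (.par p q) a (.par p' q)
  | par_right {a : Option A} {p q q' : BPP A P} :
      Step Γ q a q' → Step Γ (.par p q) a (.par p q')
  | ident {a : Option A} {X : P} {p' : BPP A P} : Step Γ (Γ X) a p' → Step Γ (.ident X) a p'

/-- Every occurrence of an identifier in the expression is within the scope of an action prefix
(the prefixing action may be `τ`). -/
def Guarded : BPP A P → Prop
  | .dl => True
  | .emp => True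
  | .pre _ _ => True
  | .alt p q => p.Guarded ∧ q.Guarded
  | .par p q => p.Guarded ∧ q.Guarded
  | .ident _ => False

/-- Weak guardedness of a recursive specification. -/
def WeaklyGuarded (Γ : P → BPP A P) : Prop :=
  ∀ X, (Γ X).Guarded

/-- The process graph of the recursive specification `Γ` with initial identifier `X`. -/
def graph (Γ : P → BPP A P) (X : P) : PGraph (BPP A P) A where
  step := Step Γ
  accepting := Accepts Γ
  root := .ident X

end BPP

/-! Say that an expression has value `n` if it is related to a counter state whose bag holds `n`
elements. A state of value `n` can do exactly `n` times `b` before a `c`, up to `τ`-steps. The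
counter has no `τ`-steps, so `τ`-steps keep the value, and preservation of divergence forbids
infinite `τ`-sequences. Hence every state of value `n` reaches a stable state of value `n`. In a
stable state of value `n`, one parallel component alone can do the `n` steps `b` and then `c`
(`exists_leaf_countsDown`). BPP has no communication: a `b`-step changes one component, the others
remain stable, and the `τ`-steps that follow come from what that component became. So the component
that counts down from `n` after the step descends from the one that moved. Had it been present
before, it could do `c` after only `n` steps `b` from a state of value `n + 1`. The components of
reachable states belong to a finite set (`specSubexprs_finite`, `Step.leaves_subset`), whereas all
values are reachable. But a component that counts down from `n` within a state of value `n` cannot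
count down from any other number, so infinitely many distinct components are needed: a
contradiction. -/

namespace BPP

variable {A P : Type*}

/-! ### Parallel components and the finite set in which they lie -/

/-- The parallel components of an expression. -/
def leaves : BPP A P → Set (BPP A P)
  | .par p q => p.leaves ∪ q.leaves
  | .dl => {.dl}
  | .emp => {.emp}
  | .pre a p => {.pre a p}
  | .alt p q => {.alt p q}
  | .ident X => {.ident X}

/-- The subexpressions of an expression. -/
def subexprs : BPP A P → Set (BPP A P)
  | .par p q => insert (.par p q) (p.subexprs ∪ q.subexprs)
  | .dl => {.dl}
  | .emp => {.emp}
  | .pre a p => insert (.pre a p) p.subexprs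
  | .alt p q => insert (.alt p q) (p.subexprs ∪ q.subexprs)
  | .ident X => {.ident X}

/-- The identifiers and the subexpressions of their definitions. -/
def specSubexprs (Γ : P → BPP A P) : Set (BPP A P) :=
  (Set.range fun X : P => (.ident X : BPP A P)) ∪ ⋃ X, (Γ X).subexprs

theorem subexprs_finite (p : BPP A P) : p.subexprs.Finite := by
  induction p with
  | dl => exact Set.finite_singleton _
  | emp => exact Set.finite_singleton _
  | ident X => exact Set.finite_singleton _
  | pre a p ih => exact ih.insert _
  | alt p q ihp ihq => exact (ihp.union ihq).insert _
  | par p q ihp ihq => exact (ihp.union ihq).insert _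

theorem specSubexprs_finite [Finite P] (Γ : P → BPP A P) : (specSubexprs Γ).Finite :=
  (Set.finite_range _).union (Set.finite_iUnion fun X => (Γ X).subexprs_finite)

theorem self_mem_subexprs (p : BPP A P) : p ∈ p.subexprs := by
  cases p <;> simp [subexprs]

theorem subexprs_trans {p q : BPP A P} (h : q ∈ p.subexprs) : q.subexprs ⊆ p.subexprs := by
  induction p with
  | dl => rw [show q = .dl from h]
  | emp => rw [show q = .emp from h]
  | ident X => rw [show q = .ident X from h]
  | pre a p ih =>
    rcases h with rfl | h
    · exact subset_rfl
    · exact (ih h).trans (Set.subset_insert _ _)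
  | alt p r ihp ihr =>
    rcases h with rfl | h | h
    · exact subset_rfl
    · exact (ihp h).trans (Set.subset_union_left.trans (Set.subset_insert _ _))
    · exact (ihr h).trans (Set.subset_union_right.trans (Set.subset_insert _ _))
  | par p r ihp ihr =>
    rcases h with rfl | h | h
    · exact subset_rfl
    · exact (ihp h).trans (Set.subset_union_left.trans (Set.subset_insert _ _))
    · exact (ihr h).trans (Set.subset_union_right.trans (Set.subset_insert _ _))

theorem leaves_subset_subexprs (p : BPP A P) : p.leaves ⊆ p.subexprs := by
  induction p with
  | par p q ihp ihq => exact (Set.union_subset_union ihp ihq).trans (Set.subset_insert _ _)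
  | _ => exact Set.singleton_subset_iff.2 (self_mem_subexprs _)

theorem subexprs_subset_specSubexprs {Γ : P → BPP A P} {p : BPP A P} (h : p ∈ specSubexprs Γ) :
    p.subexprs ⊆ specSubexprs Γ := by
  rcases h with ⟨X, rfl⟩ | h
  · exact Set.singleton_subset_iff.2 (Or.inl ⟨X, rfl⟩)
  · obtain ⟨X, hX⟩ := Set.mem_iUnion.1 h
    exact ((subexprs_trans hX).trans (Set.subset_iUnion (fun X => (Γ X).subexprs) X)).trans
      Set.subset_union_right

theorem leaves_subset_specSubexprs_of_mem {Γ : P → BPP A P} {p q : BPP A P}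
    (h : p ∈ specSubexprs Γ) (hq : q ∈ p.subexprs) : q.leaves ⊆ specSubexprs Γ :=
  (q.leaves_subset_subexprs.trans (subexprs_trans hq)).trans (subexprs_subset_specSubexprs h)

/-- A step only uncovers subexpressions of a component or of the definition of an identifier.
Outside the parallel cases the expression is its own only leaf, whence `hp rfl`. -/
theorem Step.leaves_subset {Γ : P → BPP A P} {p p' : BPP A P} {α : Option A}
    (h : Step Γ p α p') (hp : p.leaves ⊆ specSubexprs Γ) : p'.leaves ⊆ specSubexprs Γ := by
  induction h with
  | pre =>
    exact leaves_subset_specSubexprs_of_mem (hp rfl) (Or.inr (self_mem_subexprs _))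
  | alt_left _ ih =>
    exact ih (leaves_subset_specSubexprs_of_mem (hp rfl) (Or.inr (Or.inl (self_mem_subexprs _))))
  | alt_right _ ih =>
    exact ih (leaves_subset_specSubexprs_of_mem (hp rfl) (Or.inr (Or.inr (self_mem_subexprs _))))
  | par_left _ ih =>
    obtain ⟨h₁, h₂⟩ := Set.union_subset_iff.1 hp
    exact Set.union_subset (ih h₁) h₂
  | par_right _ ih =>
    obtain ⟨h₁, h₂⟩ := Set.union_subset_iff.1 hp
    exact Set.union_subset h₁ (ih h₂)
  | @ident _ X _ _ ih =>
    have h : (Γ X).subexprs ⊆ specSubexprs Γ :=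
      (Set.subset_iUnion (fun X => (Γ X).subexprs) X).trans Set.subset_union_right
    exact ih ((leaves_subset_subexprs _).trans h)

/-! ### Silent steps and stable expressions -/

/-- `τ`-reachability of expressions. -/
abbrev Taus (Γ : P → BPP A P) : BPP A P → BPP A P → Prop :=
  Relation.ReflTransGen fun p q => Step Γ p none q

theorem Taus.leaves_subset {Γ : P → BPP A P} {p p' : BPP A P}
    (h : Taus Γ p p') (hp : p.leaves ⊆ specSubexprs Γ) : p'.leaves ⊆ specSubexprs Γ := by
  induction h with
  | refl => exact hp
  | tail _ h ih => exact h.leaves_subset ih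

/-- An expression is stable if it has no `τ`-step. -/
def Stable (Γ : P → BPP A P) (p : BPP A P) : Prop := ∀ p', ¬ Step Γ p none p'

theorem Stable.eq_of_taus {Γ : P → BPP A P} {p p' : BPP A P} (hp : Stable Γ p)
    (h : Taus Γ p p') : p' = p := by
  rcases h.cases_head with h | ⟨q, hq, -⟩
  · exact h.symm
  · exact (hp q hq).elim

theorem Stable.left {Γ : P → BPP A P} {p q : BPP A P} (h : Stable Γ (.par p q)) : Stable Γ p :=
  fun _ hs => h _ (.par_left hs)

theorem Stable.right {Γ : P → BPP A P} {p q : BPP A P} (h : Stable Γ (.par p q)) : Stable Γ q :=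
  fun _ hs => h _ (.par_right hs)

theorem Stable.taus_par_left {Γ : P → BPP A P} {p q r : BPP A P} (hq : Stable Γ q)
    (h : Taus Γ (.par p q) r) : ∃ p', r = .par p' q ∧ Taus Γ p p' := by
  induction h with
  | refl => exact ⟨p, rfl, .refl⟩
  | tail _ h ih =>
    obtain ⟨p', rfl, hp'⟩ := ih
    cases h with
    | par_left h => exact ⟨_, rfl, hp'.tail h⟩
    | par_right h => exact (hq _ h).elim

theorem Stable.taus_par_right {Γ : P → BPP A P} {p q r : BPP A P} (hp : Stable Γ p)
    (h : Taus Γ (.par p q) r) : ∃ q', r = .par p q' ∧ Taus Γ q q' := by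
  induction h with
  | refl => exact ⟨q, rfl, .refl⟩
  | tail _ h ih =>
    obtain ⟨q', rfl, hq'⟩ := ih
    cases h with
    | par_left h => exact (hp _ h).elim
    | par_right h => exact ⟨_, rfl, hq'.tail h⟩

/-! ### Counting down, in an expression and in its components -/

/-- The expression can perform `n` times the action `b` and then the action `c`, with `τ`-steps
in between. -/
inductive CountsDown (Γ : P → BPP A P) (b c : A) : ℕ → BPP A P → Prop
  | zero {p p' : BPP A P} : Step Γ p (some c) p' → CountsDown Γ b c 0 p
  | tau {n : ℕ} {p p' : BPP A P} :
      Step Γ p none p' → CountsDown Γ b c n p' → CountsDown Γ b c n p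
  | succ {n : ℕ} {p p' : BPP A P} :
      Step Γ p (some b) p' → CountsDown Γ b c n p' → CountsDown Γ b c (n + 1) p

section CountsDown

variable {Γ : P → BPP A P} {b c : A}

theorem CountsDown.par_left {n : ℕ} {p q : BPP A P} (h : CountsDown Γ b c n p) :
    CountsDown Γ b c n (.par p q) := by
  induction h with
  | zero h => exact .zero (.par_left h)
  | tau h _ ih => exact .tau (.par_left h) ih
  | succ h _ ih => exact .succ (.par_left h) ih

theorem CountsDown.par_right {n : ℕ} {p q : BPP A P} (h : CountsDown Γ b c n q) :
    CountsDown Γ b c n (.par p q) := by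
  induction h with
  | zero h => exact .zero (.par_right h)
  | tau h _ ih => exact .tau (.par_right h) ih
  | succ h _ ih => exact .succ (.par_right h) ih

theorem CountsDown.of_leaf {n : ℕ} {p q : BPP A P} (hq : q ∈ p.leaves)
    (h : CountsDown Γ b c n q) : CountsDown Γ b c n p := by
  induction p with
  | par p r ihp ihr =>
    rcases hq with hq | hq
    · exact (ihp hq).par_left
    · exact (ihr hq).par_right
  | _ => exact (show q = _ from hq) ▸ h

theorem CountsDown.of_taus {n : ℕ} {p q : BPP A P} (hpq : Taus Γ p q)
    (h : CountsDown Γ b c n q) : CountsDown Γ b c n p := by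
  induction hpq using Relation.ReflTransGen.head_induction_on with
  | refl => exact h
  | head hs _ ih => exact .tau hs ih

theorem exists_leaf_step {p p' : BPP A P} {α : Option A} (h : Step Γ p α p') :
    ∃ q ∈ p.leaves, ∃ q', Step Γ q α q' := by
  induction p generalizing p' with
  | par p r ihp ihr =>
    cases h with
    | par_left h =>
      obtain ⟨q, hq, hs⟩ := ihp h
      exact ⟨q, Or.inl hq, hs⟩
    | par_right h =>
      obtain ⟨q, hq, hs⟩ := ihr h
      exact ⟨q, Or.inr hq, hs⟩
  | _ => exact ⟨_, rfl, _, h⟩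

/-- If a stable expression does a `b`-step followed by `τ`-steps, then a parallel component of
the result is already present, or it stems from a component that does the `b`-step. -/
theorem Stable.exists_leaf_countsDown {n : ℕ} {p p' p'' q : BPP A P} (hp : Stable Γ p)
    (hb : Step Γ p (some b) p') (hτ : Taus Γ p' p'') (hq : q ∈ p''.leaves)
    (hn : CountsDown Γ b c n q) :
    ∃ r ∈ p.leaves, CountsDown Γ b c n r ∨ CountsDown Γ b c (n + 1) r := by
  induction p generalizing p' p'' with
  | par p₁ p₂ ih₁ ih₂ =>
    cases hb with
    | par_left hb =>
      -- The idle component is stable, so all later `τ`-steps belong to the side that did the `b`.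
      obtain ⟨p₁'', rfl, h₁⟩ := hp.right.taus_par_left hτ
      rcases hq with hq | hq
      · obtain ⟨r, hr, h⟩ := ih₁ hp.left hb h₁ hq
        exact ⟨r, Or.inl hr, h⟩
      · exact ⟨q, Or.inr hq, Or.inl hn⟩
    | par_right hb =>
      obtain ⟨p₂'', rfl, h₂⟩ := hp.left.taus_par_right hτ
      rcases hq with hq | hq
      · exact ⟨q, Or.inl hq, Or.inl hn⟩
      · obtain ⟨r, hr, h⟩ := ih₂ hp.right hb h₂ hq
        exact ⟨r, Or.inr hr, h⟩
  -- A single component did the `b` itself, so it counts down once more than its descendant `q`.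
  | _ => exact ⟨_, rfl, Or.inr (.succ hb (.of_taus hτ (.of_leaf hq hn)))⟩

end CountsDown

/-! ### Expressions with a counter value -/

/-- A relation between expressions and natural numbers with the transfer properties, in terms of
steps of expressions, of divergence-preserving branching bisimilarity with the states of the
counter with a change. -/
structure RepresentsCounter (Γ : P → BPP A P) (a b c : A) (V : BPP A P → ℕ → Prop) : Prop where
  tau {p p' n} : V p n → Step Γ p none p' → V p' n
  of_b {p p' n} : V p n → Step Γ p (some b) p' → ∃ k, n = k + 1 ∧ V p' k
  of_c {p p' n} : V p n → Step Γ p (some c) p' → n = 0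
  exists_a {p n} : V p (n + 1) → ∃ p'' p', Taus Γ p p'' ∧ Step Γ p'' (some a) p' ∧ V p' (n + 2)
  exists_b {p n} : V p (n + 1) → ∃ p'' p', Taus Γ p p'' ∧ Step Γ p'' (some b) p' ∧ V p' n
  exists_c {p} : V p 0 → ∃ p'' p', Taus Γ p p'' ∧ Step Γ p'' (some c) p' ∧ V p' 1
  convergent {p n} : V p n → ¬ ∃ f : ℕ → BPP A P, f 0 = p ∧ ∀ i, Step Γ (f i) none (f (i + 1))

namespace RepresentsCounter

variable {Γ : P → BPP A P} {a b c : A} {V : BPP A P → ℕ → Prop}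

theorem taus (h : RepresentsCounter Γ a b c V) {p p' : BPP A P} {n : ℕ} (hp : V p n)
    (hτ : Taus Γ p p') : V p' n := by
  induction hτ with
  | refl => exact hp
  | tail _ hs ih => exact h.tau ih hs

/-- Each `b` lowers the value by one, `τ` keeps it, and `c` requires it to be zero. -/
theorem eq_of_countsDown (h : RepresentsCounter Γ a b c V) {p : BPP A P} {n k : ℕ} (hp : V p n)
    (hk : CountsDown Γ b c k p) : k = n := by
  induction hk generalizing n with
  | zero hs => exact (h.of_c hp hs).symm
  | tau hs _ ih => exact ih (h.tau hp hs)
  | succ hs _ ih =>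
    obtain ⟨m, rfl, hm⟩ := h.of_b hp hs
    rw [ih hm]

theorem exists_stable (h : RepresentsCounter Γ a b c V) {p : BPP A P} {n : ℕ} (hp : V p n) :
    ∃ p', Taus Γ p p' ∧ Stable Γ p' := by
  by_contra! hns
  have hnext : ∀ q : {q // Taus Γ p q}, ∃ r : {q // Taus Γ p q}, Step Γ q.1 none r.1 := by
    rintro ⟨q, hq⟩
    obtain ⟨r, hr⟩ := not_forall_not.1 (hns q hq)
    exact ⟨⟨r, hq.tail hr⟩, hr⟩
  choose g hg using hnext
  -- If no reachable state is stable, iterating a choice of successors gives a divergence.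
  refine h.convergent hp ⟨fun i => (g^[i] ⟨p, .refl⟩).1, rfl, fun i => ?_⟩
  simp only [Function.iterate_succ_apply']
  exact hg _

/-- This is the heart of the proof: the whole count resides in one component. Stability makes the
weak `b` or `c` start at `p` itself. -/
theorem exists_leaf_countsDown (h : RepresentsCounter Γ a b c V) {p : BPP A P} {n : ℕ}
    (hp : V p n) (hs : Stable Γ p) : ∃ q ∈ p.leaves, CountsDown Γ b c n q := by
  induction n generalizing p with
  | zero =>
    obtain ⟨p'', p', hτ, hc, -⟩ := h.exists_c hp
    obtain rfl := hs.eq_of_taus hτ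
    obtain ⟨q, hq, q', hq'⟩ := exists_leaf_step hc
    exact ⟨q, hq, .zero hq'⟩
  | succ n ih =>
    obtain ⟨p₁, p', hτ, hb, hp'⟩ := h.exists_b hp
    obtain rfl := hs.eq_of_taus hτ
    obtain ⟨p'', hτ', hs'⟩ := h.exists_stable hp'
    obtain ⟨q, hq, hn⟩ := ih (h.taus hp' hτ') hs'
    obtain ⟨r, hr, hr' | hr'⟩ := hs.exists_leaf_countsDown hb hτ' hq hn
    -- Here the component of `p` would count down from `n`, although `p` has value `n + 1`.
    · exact absurd (h.eq_of_countsDown hp (.of_leaf hr hr')) n.lt_succ_self.ne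
    · exact ⟨r, hr, hr'⟩

theorem exists_value (h : RepresentsCounter Γ a b c V) {p₀ : BPP A P} (h₀ : V p₀ 0)
    (hl : p₀.leaves ⊆ specSubexprs Γ) (n : ℕ) :
    ∃ p, V p n ∧ p.leaves ⊆ specSubexprs Γ := by
  induction n with
  | zero => exact ⟨p₀, h₀, hl⟩
  | succ n ih =>
    obtain ⟨p, hp, hpl⟩ := ih
    -- An empty bag grows by `c`, since `a` needs an element.
    cases n with
    | zero =>
      obtain ⟨p'', p', hτ, hc, hp'⟩ := h.exists_c hp
      exact ⟨p', hp', hc.leaves_subset (hτ.leaves_subset hpl)⟩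
    | succ n =>
      obtain ⟨p'', p', hτ, ha, hp'⟩ := h.exists_a hp
      exact ⟨p', hp', ha.leaves_subset (hτ.leaves_subset hpl)⟩

theorem not_represents_ident [Finite P] (h : RepresentsCounter Γ a b c V) (X : P) :
    ¬ V (.ident X) 0 := by
  intro h₀
  have key : ∀ n, ∃ q ∈ specSubexprs Γ, CountsDown Γ b c n q ∧ ∃ p, V p n ∧ q ∈ p.leaves := by
    intro n
    obtain ⟨p, hp, hl⟩ :=
      h.exists_value h₀ (Set.singleton_subset_iff.2 (Or.inl ⟨X, rfl⟩)) n
    obtain ⟨p', hτ, hs⟩ := h.exists_stable hp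
    obtain ⟨q, hq, hn⟩ := h.exists_leaf_countsDown (h.taus hp hτ) hs
    exact ⟨q, hτ.leaves_subset hl hq, hn, p', h.taus hp hτ, hq⟩
  choose q hq hn p hp hqp using key
  have hinj : Function.Injective q := by
    intro m n hmn
    -- The common component lies in a state of value `n` and counts down from `m`.
    exact h.eq_of_countsDown (hp n) (.of_leaf (hqp n) (hmn ▸ hn m))
  exact Set.infinite_of_injective_forall_mem hinj hq (specSubexprs_finite Γ)

end RepresentsCounter

end BPP

/-! ### The graph of the counter and the passage from bisimulations to values -/

section Counter

variable {A : Type*} {a b c : A}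

/-- The steps of the counter with a change, by the number of elements of the bag. -/
theorem counterWithChange_step_iff {x y : Unit × Multiset Unit} {α : Option A} :
    (counterWithChange a b c).Step x α y ↔
      (α = some c ∧ x.2.card = 0 ∧ y.2.card = 1) ∨
      (α = some a ∧ x.2.card ≠ 0 ∧ y.2.card = x.2.card + 1) ∨
      (α = some b ∧ x.2.card = y.2.card + 1) := by
  -- With a single datum, the bag is determined by its size.
  have ext : ∀ m m' : Multiset Unit, m.card = m'.card → m = m' := fun m m' h => by
    rw [Multiset.eq_replicate_card.2 fun u (_ : u ∈ m) => Subsingleton.elim u (),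
      Multiset.eq_replicate_card.2 fun u (_ : u ∈ m') => Subsingleton.elim u (), h]
  constructor
  · rintro (@⟨_, _, _, _, z, z', h⟩ | @⟨_, _, _, d, z, z', hd, h⟩)
    · simp only [counterWithChange, Set.mem_insert_iff, Set.mem_singleton_iff, Prod.mk.injEq,
        reduceCtorEq, false_and, and_false, false_or] at h
      rcases h with ⟨-, rfl, -, rfl, -⟩ | ⟨-, rfl, -, rfl, -⟩
      · refine Or.inr (Or.inl ⟨rfl, ?_, ?_⟩) <;> simp
      · refine Or.inr (Or.inr ⟨rfl, ?_⟩)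
        simp
    · simp only [counterWithChange, Set.mem_insert_iff, Set.mem_singleton_iff, Prod.mk.injEq,
        reduceCtorEq, false_and, and_false, or_false] at h
      obtain ⟨-, rfl, -, rfl, -⟩ := h
      have : z = 0 := Multiset.eq_zero_of_forall_notMem fun u => Subsingleton.elim d u ▸ hd
      exact Or.inl ⟨rfl, by simp [this], by simp [this]⟩
  · obtain ⟨u, m⟩ := x
    obtain ⟨v, m'⟩ := y
    rintro (⟨rfl, h, h'⟩ | ⟨rfl, h, h'⟩ | ⟨rfl, h⟩)
    · obtain rfl := ext m 0 (by simpa using h)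
      obtain rfl := ext m' ({()} + 0) (by simpa using h')
      exact .neg (d := ()) (by simp) (by simp [counterWithChange])
    · obtain ⟨k, hk⟩ := Nat.exists_eq_succ_of_ne_zero h
      obtain rfl := ext m ({()} + Multiset.replicate k ()) (by simp at hk ⊢; omega)
      obtain rfl := ext m' ({(), ()} + Multiset.replicate k ()) (by simp at h' ⊢; omega)
      exact .pos (by simp [counterWithChange])
    · obtain rfl := ext m ({()} + m') (by simp at h ⊢; omega)
      have : PPDA.Step (counterWithChange a b c) (u, {()} + m') (some b) (v, 0 + m') :=
        .pos (by simp [counterWithChange])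
      rwa [zero_add] at this

variable {P : Type*} {Γ : P → BPP A P} {X : P}

theorem LTS.disjointUnion_taus_inl {S₁ S₂ : Type*} {T₁ : LTS S₁ A} {T₂ : LTS S₂ A}
    {p : S₁} {t : S₁ ⊕ S₂} (h : (LTS.disjointUnion T₁ T₂).TauSteps (.inl p) t) :
    ∃ q, t = .inl q ∧ T₁.TauSteps p q := by
  induction h with
  | refl => exact ⟨p, rfl, .refl⟩
  | @tail _ r _ h ih =>
    obtain ⟨q, rfl, hq⟩ := ih
    cases r with
    | inl r => exact ⟨r, rfl, hq.tail h⟩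
    | inr r => exact h.elim

theorem counterWithChange_not_tau {x : Unit × Multiset Unit}
    {t : BPP A P ⊕ (Unit × Multiset Unit)} :
    ¬ (LTS.disjointUnion (BPP.graph Γ X).toLTS (counterWithChange a b c).graph.toLTS).step
      (.inr x) none t := by
  intro h
  cases t with
  | inl t => exact h
  | inr t => simpa using counterWithChange_step_iff.1 h

theorem counterWithChange_taus {x : Unit × Multiset Unit}
    {t : BPP A P ⊕ (Unit × Multiset Unit)}
    (h : (LTS.disjointUnion (BPP.graph Γ X).toLTS
      (counterWithChange a b c).graph.toLTS).TauSteps (.inr x) t) : t = .inr x := by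
  rcases h.cases_head with h | ⟨q, hq, -⟩
  · exact h.symm
  · exact (counterWithChange_not_tau hq).elim

/-- The counter answers every step of an expression without `τ`-steps of its own; distinctness of
the actions then identifies which of its three transitions answers. -/
theorem representsCounter_of_bisimulation (hab : a ≠ b) (hac : a ≠ c) (hbc : b ≠ c)
    {R : BPP A P ⊕ (Unit × Multiset Unit) → BPP A P ⊕ (Unit × Multiset Unit) → Prop}
    (hR : (LTS.disjointUnion (BPP.graph Γ X).toLTS
      (counterWithChange a b c).graph.toLTS).IsBranchingBisimulation R)
    (hD : (LTS.disjointUnion (BPP.graph Γ X).toLTS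
      (counterWithChange a b c).graph.toLTS).DivergencePreserving R) :
    BPP.RepresentsCounter Γ a b c fun p n => ∃ x, x.2.card = n ∧ R (.inl p) (.inr x) := by
  have forth_tau {p p' : BPP A P} {x} (h : R (.inl p) (.inr x)) (hs : BPP.Step Γ p none p') :
      R (.inl p') (.inr x) := by
    obtain ⟨t', t'', h₁, h₂, -, h₄⟩ := hR.transfer _ _ h none (.inl p') hs
    obtain rfl := counterWithChange_taus h₁
    rcases h₂ with h₂ | ⟨-, rfl⟩
    · exact (counterWithChange_not_tau h₂).elim
    · exact h₄
  have forth {p p' : BPP A P} {x} {α : A} (h : R (.inl p) (.inr x))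
      (hs : BPP.Step Γ p (some α) p') :
      ∃ y, (counterWithChange a b c).Step x (some α) y ∧ R (.inl p') (.inr y) := by
    obtain ⟨t', t'', h₁, h₂, -, h₄⟩ := hR.transfer _ _ h (some α) (.inl p') hs
    obtain rfl := counterWithChange_taus h₁
    rcases h₂ with h₂ | ⟨h₂, -⟩
    · cases t' with
      | inl t' => exact h₂.elim
      | inr t' => exact ⟨t', h₂, h₄⟩
    · cases h₂
  have back {p : BPP A P} {x y} {α : A} (h : R (.inl p) (.inr x))
      (hs : (counterWithChange a b c).Step x (some α) y) :
      ∃ p'' p', BPP.Taus Γ p p'' ∧ BPP.Step Γ p'' (some α) p' ∧ R (.inl p') (.inr y) := by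
    obtain ⟨t', t'', h₁, h₂, -, h₄⟩ := hR.transfer _ _ (hR.symm _ _ h) (some α) (.inr y) hs
    obtain ⟨q, rfl, hq⟩ := LTS.disjointUnion_taus_inl h₁
    rcases h₂ with h₂ | ⟨h₂, -⟩
    · cases t' with
      | inl t' => exact ⟨q, t', hq, h₂, hR.symm _ _ h₄⟩
      | inr t' => exact h₂.elim
    · cases h₂
  refine ⟨?_, ?_, ?_, ?_, ?_, ?_, ?_⟩
  · rintro p p' n ⟨x, hx, h⟩ hs
    exact ⟨x, hx, forth_tau h hs⟩
  · rintro p p' n ⟨x, rfl, h⟩ hs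
    obtain ⟨y, hy, h'⟩ := forth h hs
    have := counterWithChange_step_iff.1 hy
    simp only [Option.some.injEq, hbc, hab.symm, false_and, true_and, false_or] at this
    exact ⟨_, this, y, rfl, h'⟩
  · rintro p p' n ⟨x, rfl, h⟩ hs
    obtain ⟨y, hy, -⟩ := forth h hs
    have := counterWithChange_step_iff.1 hy
    simp only [Option.some.injEq, hbc.symm, hac.symm, false_and, true_and, or_false] at this
    exact this.1
  · rintro p n ⟨x, hx, h⟩
    obtain ⟨p'', p', h₁, h₂, h₃⟩ := back (y := ((), Multiset.replicate (n + 2) ())) h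
      (counterWithChange_step_iff.2 (Or.inr (Or.inl ⟨rfl, by omega, by simp [hx]⟩)))
    exact ⟨p'', p', h₁, h₂, _, by simp, h₃⟩
  · rintro p n ⟨x, hx, h⟩
    obtain ⟨p'', p', h₁, h₂, h₃⟩ := back (y := ((), Multiset.replicate n ())) h
      (counterWithChange_step_iff.2 (Or.inr (Or.inr ⟨rfl, by simp [hx]⟩)))
    exact ⟨p'', p', h₁, h₂, _, by simp, h₃⟩
  · rintro p ⟨x, hx, h⟩
    obtain ⟨p'', p', h₁, h₂, h₃⟩ := back (y := ((), {()})) h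
      (counterWithChange_step_iff.2 (Or.inl ⟨rfl, hx, by simp⟩))
    exact ⟨p'', p', h₁, h₂, _, by simp, h₃⟩
  · rintro p n ⟨x, -, h⟩ ⟨f, rfl, hf⟩
    have hall : ∀ i, R (.inl (f i)) (.inr x) := fun i => by
      induction i with
      | zero => exact h
      | succ i ih => exact forth_tau ih (hf i)
    -- All states of the divergence are related to the same `x`, so `x` would need a `τ`-step.
    obtain ⟨t', ht', -⟩ := hD _ (.inr x) (fun i => .inl (f i)) rfl hf hall
    obtain ⟨q, hq, -⟩ := Relation.TransGen.head'_iff.1 ht'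
    exact counterWithChange_not_tau hq

end Counter

theorem mainTheorem6 {A : Type*} (a b c : A) (hab : a ≠ b) (hac : a ≠ c) (hbc : b ≠ c)
    {P : Type*} [Finite P] (Γ : P → BPP A P) (hΓ : BPP.WeaklyGuarded Γ) (X : P) :
    ¬ (BPP.graph Γ X).DPBranchingBisimilar (counterWithChange a b c).graph := by
  rintro ⟨R, hR, hD, h⟩
  exact (representsCounter_of_bisimulation hab hac hbc hR hD).not_represents_ident X
    ⟨((), 0), rfl, h⟩
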